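/- Call a sequence $(M_k)_{k\ge 0}$ of positive real numbers a weight sequence. For a weight sequence $(M_k)$, let $C_{\mathrm{loc}}\{M_k\}$ be the set of all $C^\infty$ functions $f:\mathbb{R}\to\mathbb{R}$ such that for every compact interval $K=[a,b]$ with $a<b$ there are $\beta,B>0$ with $$\sup_{x\in K}|f^{(k)}(x)|\le \beta B^k M_k\qquad\text{for all } k\ge 0 .$$ A locally Denjoy–Carleman class is a set of functions of the form $C_{\mathrm{loc}}\{M_k\}$ for some weight sequence $(M_k)$; no log-convexity or quasi-analyticity is assumed. A predictor for functions from $\mathbb{R}$ to $\mathbb{R}$ is a map $\mathcal{P}$ that assigns to every $t\in\mathbb{R}$ and every function $f:(-\infty,t)\to\mathbb{R}$ a real number $\mathcal{P}(f)$. It is good if for every function $F:\mathbb{R}\to\mathbb{R}$ (with no regularity assumed) the set $\{t\in\mathbb{R} : \mathcal{P}(F\restriction(-\infty,t))\ne F(t)\}$ has Lebesgue measure zero. Given a set $\Gamma$ of functions from $\mathbb{R}$ to $\mathbb{R}$, the predictor $\mathcal{P}$ is $\Gamma$-anonymous if for every increasing bijection $\varphi:\mathbb{R}\to\mathbb{R}$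 belonging to $\Gamma$, every $t\in\mathbb{R}$ and every $f:(-\infty,\varphi(t))\to\mathbb{R}$, $$\mathcal{P}(f)=\mathcal{P}\bigl(f\circ\varphi\restriction(-\infty,t)\bigr).$$ **Corollary.** Assume the Continuum Hypothesis $2^{\aleph_0}=\aleph_1$. Then for every locally Denjoy–Carleman class $\Gamma$ there is no good $\Gamma$-anonymous predictor for functions from $\mathbb{R}$ to $\mathbb{R}$. -/

import Mathlib

open scoped ContDiff

/-- `C_K {M_k}` for the compact interval `K = [a, b]` (used with `a < b`): the functions that are
smooth on `K` (one-sided derivatives at the end points) and satisfy, for some positive `β` and `B`,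
`‖f^(k)‖ ≤ β * B ^ k * M k` for all `k`, with the supremum norm over `K`.
Only the values of the function on `K` matter. -/
def denjoyCarlemanOn (M : ℕ → ℝ) (a b : ℝ) : Set (ℝ → ℝ) :=
  {f | ContDiffOn ℝ ∞ f (Set.Icc a b) ∧
    ∃ β B : ℝ, 0 < β ∧ 0 < B ∧
      ∀ k : ℕ, ∀ x ∈ Set.Icc a b,
        |iteratedDerivWithin k f (Set.Icc a b) x| ≤ β * B ^ k * M k}

/-- `C_loc {M_k}`: the smooth functions on the real line whose restriction to every compact
interval `K` lies in `C_K {M_k}`. -/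
def denjoyCarlemanLoc (M : ℕ → ℝ) : Set (ℝ → ℝ) :=
  {f | ContDiff ℝ ∞ f ∧ ∀ a b : ℝ, a < b → f ∈ denjoyCarlemanOn M a b}

/-- A locally Denjoy–Carleman class is a class of the form `C_loc {M_k}` for a sequence of positive
reals. -/
def IsLocallyDenjoyCarleman (Γ : Set (ℝ → ℝ)) : Prop :=
  ∃ M : ℕ → ℝ, (∀ k, 0 < M k) ∧ Γ = denjoyCarlemanLoc M

/-- An `S`-predictor: to every time `t` and every past history `f : (-∞, t) → S` it assigns a guess
in `S` for the value at time `t`. -/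
abbrev Predictor (S : Type*) := (t : ℝ) → (Set.Iio t → S) → S

namespace Predictor

variable {S : Type*}

/-- `P` predicts `F` correctly at time `t`. -/
def PredictsAt (P : Predictor S) (F : ℝ → S) (t : ℝ) : Prop :=
  P t (fun u : Set.Iio t => F u) = F t

/-- A predictor is good if, for every function `F : ℝ → S` whatsoever, the set of times at which
it fails to predict `F` has Lebesgue measure zero. -/
def IsGood (P : Predictor S) : Prop :=
  ∀ F : ℝ → S, MeasureTheory.volume {t : ℝ | ¬ P.PredictsAt F t} = 0

/-- A predictor is `Γ`-anonymous if its guess does not change when time is reparametrized by an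
increasing bijection `φ : ℝ → ℝ` that belongs to `Γ`: a history `f` on `(-∞, φ t)` and the history
`f ∘ φ` on `(-∞, t)` get the same guess. -/
def IsAnonymous (Γ : Set (ℝ → ℝ)) (P : Predictor S) : Prop :=
  ∀ φ ∈ Γ, ∀ hφ : StrictMono φ, Function.Bijective φ →
    ∀ (t : ℝ) (f : Set.Iio (φ t) → S),
      P (φ t) f = P t (fun u : Set.Iio t => f ⟨φ u, hφ u.2⟩)

end Predictor

/-! Suppose some `F` has countable fibres and, for each `x`, an increasing bijection `f x` in the
class sends `x` to `0` and satisfies `F ∘ f x = F` to the left of `x`. Anonymity then forces the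
guess for `F` at `x` to equal the guess at `0`. So the guess is constant, and it is right only on
one countable fibre.

To get `F`, pick a representative in each class of the equivalence relation generated by `u ~ f x u`
for `u ≠ x`. The classes must be countable although there are uncountably many `f x`. CH supplies a
relation `E` with countable dense sections (`exists_rel_countable_dense`) and countable sets `A x`
containing each real for all but countably many `x`. If `f x` follows `E` wherever a point or its
image lies in `A x`, each real has only countably many images and preimages.

Such `f x` come from a back-and-forth argument (`exists_mem_denjoyCarlemanLoc_rel`). The map is a
limit of polynomials whose corrections are small relative to every `M k` at once, which is possible
because a polynomial has finitely many nonzero derivatives. -/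

/-- A relation with countable sections in both directions generates an equivalence relation all of
whose classes are countable. -/
theorem countable_setOf_eqvGen {α : Type*} {R : α → α → Prop}
    (h₁ : ∀ a, {b | R a b}.Countable) (h₂ : ∀ a, {b | R b a}.Countable) (a : α) :
    {b | Relation.EqvGen R a b}.Countable := by
  let T : ℕ → Set α := fun n =>
    Nat.rec {a} (fun _ s => ⋃ x ∈ s, ({b | R x b} ∪ {b | R b x})) n
  have hT : ∀ n, (T n).Countable := by
    intro n
    induction n with
    | zero => exact Set.countable_singleton a
    | succ n ih => exact ih.biUnion fun x _ => (h₁ x).union (h₂ x)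
  have step : ∀ x y, Relation.EqvGen R x y → (x ∈ ⋃ n, T n ↔ y ∈ ⋃ n, T n) := by
    intro x y hxy
    induction hxy with
    | rel x y h =>
      simp only [Set.mem_iUnion]
      constructor
      · rintro ⟨n, hn⟩
        exact ⟨n + 1, Set.mem_biUnion hn (Or.inl h)⟩
      · rintro ⟨n, hn⟩
        exact ⟨n + 1, Set.mem_biUnion hn (Or.inr h)⟩
    | refl x => exact Iff.rfl
    | symm x y _ ih => exact ih.symm
    | trans x y z _ _ ih₁ ih₂ => exact ih₁.trans ih₂
  refine (Set.countable_iUnion hT).mono fun b hb => ?_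
  exact (step a b hb).1 (Set.mem_iUnion.2 ⟨0, rfl⟩)

/-- Under the continuum hypothesis, the reals can be well-ordered with countable initial
segments. -/
theorem exists_wellOrder_real_countable (CH : Cardinal.continuum.{0} = Cardinal.aleph 1) :
    ∃ r : ℝ → ℝ → Prop, IsWellOrder ℝ r ∧ ∀ x, {y | r y x}.Countable := by
  -- The order type is the initial ordinal of the continuum, so under CH proper initial segments
  -- have cardinality below `aleph 1`.
  obtain ⟨r, hr, h⟩ := Cardinal.exists_ord_eq ℝ
  refine ⟨r, hr, fun x => ?_⟩
  have h1 := Cardinal.card_typein_lt x h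
  rw [Ordinal.card_typein, Cardinal.mk_real, CH] at h1
  rw [← Set.countable_coe_iff, ← Cardinal.mk_le_aleph0_iff]
  rw [← Order.succ_le_succ_iff, Cardinal.succ_aleph0]
  exact Order.succ_le_of_lt h1

/-- The complement of a countable set of reals contains a countable dense set. -/
theorem exists_countable_dense_disjoint {A : Set ℝ} (hA : A.Countable) :
    ∃ D : Set ℝ, D.Countable ∧ Dense D ∧ Disjoint D A := by
  have hB : (⋃ q : ℚ, (fun a : ℝ => a - q) '' A).Countable :=
    Set.countable_iUnion fun q => hA.image _
  -- With `c` outside `A - ℚ`, the dense translate `c + ℚ` misses `A`.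
  obtain ⟨c, hc⟩ : ∃ c, c ∉ ⋃ q : ℚ, (fun a : ℝ => a - q) '' A := by
    by_contra! hcon
    exact Cardinal.not_countable_real (hB.mono fun x _ => hcon x)
  refine ⟨Set.range fun q : ℚ => c + (q : ℝ), Set.countable_range _, ?_, ?_⟩
  · exact (Homeomorph.addLeft c).surjective.denseRange.comp Rat.denseRange_cast
      (Homeomorph.addLeft c).continuous
  · rw [Set.disjoint_left]
    rintro _ ⟨q, rfl⟩ hq
    exact hc (Set.mem_iUnion.2 ⟨q, c + q, hq, by ring⟩)

/-! ### Anonymity against a function with countable fibres -/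

/-- A predictor that is invariant under enough reparametrizations fixing a function with countable
fibres is not good. -/
theorem Predictor.not_isGood_of_forall_exists {Γ : Set (ℝ → ℝ)} {P : Predictor ℝ}
    (hP : P.IsAnonymous Γ) {F : ℝ → ℝ} (hF : ∀ c, {t | F t = c}.Countable)
    (h : ∀ x, ∃ φ ∈ Γ, StrictMono φ ∧ Function.Bijective φ ∧ φ x = 0 ∧ ∀ u < x, F (φ u) = F u) :
    ¬ P.IsGood := by
  intro hgood
  have key : ∀ x, P x (fun u : Set.Iio x => F u) = P 0 (fun u : Set.Iio 0 => F u) := by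
    intro x
    obtain ⟨φ, hΓ, hm, hb, hx, hF⟩ := h x
    have h1 := hP φ hΓ hm hb x (fun u => F u)
    have h2 : (fun u : Set.Iio x => F (φ u)) = fun u : Set.Iio x => F u :=
      funext fun u => hF u u.2
    simp only [h2] at h1
    rw [← h1, hx]
  have h0 := hgood F
  have h1 := (hF (P 0 fun u : Set.Iio 0 => F u)).measure_zero MeasureTheory.volume
  have h2 : (Set.univ : Set ℝ) ⊆ {t : ℝ | ¬ P.PredictsAt F t} ∪
      {t | F t = P 0 fun u : Set.Iio 0 => F u} := by
    intro t _
    by_cases ht : P.PredictsAt F t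
    · right
      rw [PredictsAt, key] at ht
      exact ht.symm
    · exact Or.inl ht
  have h3 := MeasureTheory.measure_mono_null h2 (MeasureTheory.measure_union_null h0 h1)
  simp at h3

/-! ### Polynomial estimates -/

open Polynomial Filter Topology in
theorem Polynomial.exists_forall_le_eval_of_even {p : ℝ[X]} (hdeg : Even p.natDegree)
    (hlead : 0 ≤ p.leadingCoeff) : ∃ c : ℝ, ∀ t, c ≤ p.eval t := by
  by_cases h0 : p.natDegree = 0
  · obtain ⟨a, rfl⟩ := natDegree_eq_zero.1 h0
    exact ⟨a, fun t => by simp⟩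
  have htop := p.tendsto_atTop_of_leadingCoeff_nonneg
    (natDegree_pos_iff_degree_pos.1 (Nat.pos_of_ne_zero h0)) hlead
  have hbot : Tendsto (fun t => p.eval t) atBot atTop := by
    have hd : (p.comp (-X)).natDegree = p.natDegree := by simp [natDegree_comp]
    have hl : (p.comp (-X)).leadingCoeff = p.leadingCoeff := by
      rw [leadingCoeff_comp (by simp)]
      simp [hdeg.neg_one_pow]
    have h := (p.comp (-X)).tendsto_atTop_of_leadingCoeff_nonneg
      (natDegree_pos_iff_degree_pos.1 (by omega)) (by rw [hl]; exact hlead)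
    simpa [Function.comp_def] using h.comp tendsto_neg_atBot_atTop
  obtain ⟨x, hx⟩ := p.continuous.exists_forall_le
    (by rw [cocompact_eq_atBot_atTop]; exact hbot.sup htop)
  exact ⟨_, hx⟩

-- The derivative has even degree and nonnegative leading coefficient, hence is bounded below on the
-- whole line. A small multiple of `q` therefore costs only a little slope, globally.
open Polynomial in
theorem Polynomial.exists_neg_mul_sub_le_eval_sub_of_odd {q : ℝ[X]} (hq : Odd q.natDegree)
    (hlead : 0 ≤ q.leadingCoeff) :
    ∃ C : ℝ, 0 < C ∧ ∀ s t : ℝ, s ≤ t → -C * (t - s) ≤ q.eval t - q.eval s := by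
  obtain ⟨m, hm⟩ := hq
  have hd : (derivative q).natDegree = 2 * m := by
    rw [natDegree_derivative q]; omega
  have hl : 0 ≤ (derivative q).leadingCoeff := by
    rw [leadingCoeff, hd, coeff_derivative, ← hm]
    exact mul_nonneg hlead (by positivity)
  obtain ⟨c, hc⟩ := exists_forall_le_eval_of_even (by rw [hd]; exact even_two_mul m) hl
  refine ⟨|c| + 1, by positivity, fun s t hst => ?_⟩
  have hmono : Monotone fun t => (q + C (|c| + 1) * X).eval t := by
    refine monotone_of_deriv_nonneg (q + C (|c| + 1) * X).differentiable fun t => ?_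
    rw [Polynomial.deriv]
    simp
    linarith [hc t, neg_abs_le c]
  have := hmono hst
  simp at this
  linarith

-- Only finitely many derivatives are nonzero, so positivity of the weights is enough.
open Polynomial in
theorem Polynomial.exists_abs_eval_iterate_derivative_le {M : ℕ → ℝ} (hM : ∀ k, 0 < M k)
    (q : ℝ[X]) (R : ℝ) :
    ∃ C : ℝ, 0 < C ∧ ∀ k t, |t| ≤ R → |(derivative^[k] q).eval t| ≤ C * M k := by
  have h : ∀ k, ∃ c : ℝ, 0 ≤ c ∧ ∀ t, |t| ≤ R → |(derivative^[k] q).eval t| ≤ c := by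
    intro k
    obtain ⟨c, hc⟩ := (isCompact_Icc (a := -R) (b := R)).exists_bound_of_continuousOn
      (derivative^[k] q).continuous.continuousOn
    exact ⟨|c|, abs_nonneg c, fun t ht => (hc t (abs_le.1 ht)).trans (le_abs_self c)⟩
  choose c hc0 hc using h
  have hnn : ∀ k, 0 ≤ c k / M k := fun k => div_nonneg (hc0 k) (hM k).le
  refine ⟨∑ k ∈ Finset.range (q.natDegree + 1), c k / M k + 1,
    add_pos_of_nonneg_of_pos (Finset.sum_nonneg fun k _ => hnn k) one_pos, fun k t ht => ?_⟩
  by_cases hk : k < q.natDegree + 1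
  · refine (hc k t ht).trans ?_
    rw [← div_le_iff₀ (hM k)]
    have := Finset.single_le_sum (f := fun k => c k / M k) (fun k _ => hnn k)
      (Finset.mem_range.2 hk)
    linarith
  · rw [iterate_derivative_eq_zero (by omega)]
    simp only [eval_zero, abs_zero]
    exact mul_nonneg (add_nonneg (Finset.sum_nonneg fun k _ => hnn k) one_pos.le) (hM k).le

/-! ### Polynomial series in the Denjoy–Carleman class -/

open Polynomial in
/-- A series of polynomials that converges fast enough, relative to the weights, has its sum in the
locally Denjoy–Carleman class. -/
theorem tsum_eval_mem_denjoyCarlemanLoc {M : ℕ → ℝ} (hM : ∀ k, 0 < M k) {p : ℕ → ℝ[X]}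
    {δ : ℕ → ℝ} (hδ : Summable δ) (hp : ∀ (n k : ℕ) (t : ℝ), |t| ≤ n →
      |(derivative^[k] (p (n + 1))).eval t| ≤ δ n * M k) :
    (∀ t, Summable fun n => (p n).eval t) ∧
      (fun t => ∑' n, (p n).eval t) ∈ denjoyCarlemanLoc M := by
  have hu : ∀ N : ℕ, ∃ u : ℕ → ℝ, Summable u ∧
      ∀ n k (t : ℝ), |t| ≤ N → |(derivative^[k] (p n)).eval t| ≤ u n * M k := by
    intro N
    choose C _ hC using fun n => (p n).exists_abs_eval_iterate_derivative_le hM N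
    -- The hypothesis controls `p n` on `|t| ≤ n - 1`, which covers `|t| ≤ N` once `n > N`. The
    -- finitely many earlier terms use their own constants.
    refine ⟨fun n => if n ≤ N then C n else δ (n - 1), ?_, fun n k t ht => ?_⟩
    · rw [← summable_nat_add_iff (N + 1)]
      refine ((summable_nat_add_iff N).2 hδ).congr fun n => ?_
      rw [if_neg (by omega)]
      congr 1
    · dsimp only
      split_ifs with h
      · exact hC n k t ht
      · obtain ⟨m, rfl⟩ : ∃ m, n = m + 1 := ⟨n - 1, by omega⟩
        refine hp m k t (ht.trans ?_)
        exact_mod_cast (by omega : N ≤ m)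
  have hN : ∀ t : ℝ, ∃ N : ℕ, |t| < N := fun t => exists_nat_gt _
  have hsum : ∀ k t, Summable fun n => (derivative^[k] (p n)).eval t := by
    intro k t
    obtain ⟨N, ht⟩ := hN t
    obtain ⟨u, hus, hu⟩ := hu N
    exact Summable.of_norm_bounded (hus.mul_right (M k)) fun n => hu n k t ht.le
  have hder : ∀ k t, HasDerivAt (fun z => ∑' n, (derivative^[k] (p n)).eval z)
      (∑' n, (derivative^[k + 1] (p n)).eval t) t := by
    intro k t
    obtain ⟨N, ht⟩ := hN t
    obtain ⟨u, hus, hu⟩ := hu N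
    have hmem : ∀ y : ℝ, y ∈ Metric.ball (0 : ℝ) N ↔ |y| < N := fun y => by simp
    have hg : ∀ n y, y ∈ Metric.ball (0 : ℝ) N → HasDerivAt
        (fun z => (derivative^[k] (p n)).eval z) ((derivative^[k + 1] (p n)).eval y) y := by
      intro n y _
      rw [Function.iterate_succ_apply']
      exact (derivative^[k] (p n)).hasDerivAt y
    have hg' : ∀ n y, y ∈ Metric.ball (0 : ℝ) N →
        ‖(derivative^[k + 1] (p n)).eval y‖ ≤ u n * M (k + 1) :=
      fun n y hy => hu n (k + 1) y ((hmem y).1 hy).le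
    exact hasDerivAt_tsum_of_isPreconnected (hus.mul_right (M (k + 1))) Metric.isOpen_ball
      (convex_ball (0 : ℝ) N).isPreconnected hg hg' ((hmem t).2 ht) (hsum k t) ((hmem t).2 ht)
  have hiter : ∀ k, iteratedDeriv k (fun t => ∑' n, (p n).eval t) =
      fun t => ∑' n, (derivative^[k] (p n)).eval t := by
    intro k
    induction k with
    | zero => simp
    | succ k ih =>
      rw [iteratedDeriv_succ, ih]
      exact funext fun t => (hder k t).deriv
  have hsmooth : ContDiff ℝ ∞ fun t => ∑' n, (p n).eval t := by
    refine contDiff_of_differentiable_iteratedDeriv fun k _ => ?_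
    rw [hiter]
    exact fun t => (hder k t).differentiableAt
  refine ⟨hsum 0, hsmooth, fun a b hab => ⟨hsmooth.contDiffOn, ?_⟩⟩
  obtain ⟨N, hNab⟩ := exists_nat_gt (max |a| |b|)
  obtain ⟨u, hus, hu⟩ := hu N
  have hle : ∀ (k : ℕ) (t : ℝ), |t| ≤ N → |∑' n, (derivative^[k] (p n)).eval t| ≤ (∑' n, u n) * M k := by
    intro k t ht
    rw [← tsum_mul_right]
    exact tsum_of_norm_bounded (f := fun n => (derivative^[k] (p n)).eval t)
      (hus.mul_right (M k)).hasSum fun n => hu n k t ht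
  refine ⟨|∑' n, u n| + 1, 1, by positivity, one_pos, fun k x hx => ?_⟩
  rw [iteratedDerivWithin_eq_iteratedDeriv (uniqueDiffOn_Icc hab)
    ((hsmooth.of_le (by exact_mod_cast le_top)).contDiffAt) hx, hiter, one_pow, mul_one]
  refine (hle k x ((abs_le_max_abs_abs hx.1 hx.2).trans hNab.le)).trans ?_
  exact mul_le_mul_of_nonneg_right (by linarith [le_abs_self (∑' n, u n)]) (hM k).le

/-! ### One step of the back-and-forth -/

open Polynomial in
/-- A stage of the back-and-forth construction: the polynomial `F` increases with slope at least `c`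
and has the root `x`, and all other points of `S` are related by `E` to their values. -/
structure IsStage (E : ℝ → ℝ → Prop) (x c : ℝ) (F : ℝ[X]) (S : Finset ℝ) : Prop where
  slope : ∀ s t, s ≤ t → c * (t - s) ≤ F.eval t - F.eval s
  mem : x ∈ S
  root : F.eval x = 0
  rel : ∀ s ∈ S, s ≠ x → E s (F.eval s)

open Polynomial in
/-- The odd-degree polynomial, vanishing exactly on `S`, used to perturb a stage. -/
noncomputable def perturbation (x : ℝ) (S : Finset ℝ) : ℝ[X] :=
  (X - C x) * (∏ s ∈ S, (X - C s)) ^ 2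

open Polynomial in
theorem exists_slope_perturbation (x : ℝ) (S : Finset ℝ) :
    ∃ C : ℝ, 0 < C ∧ ∀ s t : ℝ, s ≤ t →
      -C * (t - s) ≤ (perturbation x S).eval t - (perturbation x S).eval s := by
  have hm : (∏ s ∈ S, (X - C s)).Monic := monic_prod_of_monic _ _ fun s _ => monic_X_sub_C s
  have hmon : (perturbation x S).Monic := (monic_X_sub_C x).mul (hm.pow 2)
  refine exists_neg_mul_sub_le_eval_sub_of_odd ?_ (by rw [hmon.leadingCoeff]; exact zero_le_one)
  rw [perturbation, (monic_X_sub_C x).natDegree_mul (hm.pow 2), hm.natDegree_pow,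
    natDegree_X_sub_C, add_comm]
  exact odd_two_mul_add_one _

open Polynomial in
theorem eval_perturbation (x : ℝ) (S : Finset ℝ) (t : ℝ) :
    (perturbation x S).eval t = (t - x) * (∏ s ∈ S, (t - s)) ^ 2 := by
  simp [perturbation, eval_prod]

theorem prod_sub_sq_pos {S : Finset ℝ} {t : ℝ} (ht : t ∉ S) : 0 < (∏ s ∈ S, (t - s)) ^ 2 :=
  sq_pos_of_ne_zero (Finset.prod_ne_zero_iff.2 fun s hs h => ht (by rwa [sub_eq_zero.1 h]))

open Polynomial in
theorem eval_perturbation_of_mem {x : ℝ} {S : Finset ℝ} {s : ℝ} (hs : s ∈ S) :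
    (perturbation x S).eval s = 0 := by
  rw [eval_perturbation, Finset.prod_eq_zero hs (sub_self s)]
  simp

theorem surjective_of_continuous_of_slope {f : ℝ → ℝ} (hf : Continuous f) {c : ℝ}
    (hc : 0 < c) (h : ∀ s t, s ≤ t → c * (t - s) ≤ f t - f s) : Function.Surjective f := by
  refine hf.surjective ?_ ?_
  · refine Filter.tendsto_atTop_mono' _ (f₁ := fun t => c * t + f 0) ?_ ?_
    · filter_upwards [Filter.eventually_ge_atTop 0] with t ht
      linarith [h 0 t ht]
    · exact Filter.tendsto_atTop_add_const_right _ _ (Filter.tendsto_id.const_mul_atTop hc)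
  · refine Filter.tendsto_atBot_mono' _ (f₁ := fun t => c * t + f 0) ?_ ?_
    · filter_upwards [Filter.eventually_le_atBot 0] with t ht
      linarith [h t 0 ht]
    · exact Filter.tendsto_atBot_add_const_right _ _ (Filter.tendsto_id.const_mul_atBot hc)

-- Take `G = F + ε q` with `q` vanishing on `S`, so earlier values persist. To put `v` in the
-- domain, `v` is fixed and `ε` varies; to put `v` in the range, the preimage and `ε` vary together.
-- Density of the sections of `E` meets the open set of admissible choices.
open Polynomial in
theorem IsStage.exists_extension {E : ℝ → ℝ → Prop} {x c : ℝ} {F : ℝ[X]} {S : Finset ℝ}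
    (h : IsStage E x c F S) (hc : 0 < c) (hE₁ : ∀ u, Dense {v | E u v})
    (hE₂ : ∀ v, Dense {u | E u v}) {M : ℕ → ℝ} (hM : ∀ k, 0 < M k) {δ : ℝ} (hδ : 0 < δ) (R : ℝ)
    (b : Bool) (v : ℝ) :
    ∃ (G : ℝ[X]) (T : Finset ℝ), IsStage E x (c - δ) G T ∧ S ⊆ T ∧
      (∀ s ∈ S, G.eval s = F.eval s) ∧
      (∀ (k : ℕ) (t : ℝ), |t| ≤ R → |(derivative^[k] (G - F)).eval t| ≤ δ * M k) ∧
      (if b then v ∈ T else ∃ s ∈ T, G.eval s = v) := by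
  classical
  obtain ⟨A, hA, hslope⟩ := exists_slope_perturbation x S
  obtain ⟨B, hB, hbound⟩ := (perturbation x S).exists_abs_eval_iterate_derivative_le hM R
  set q := perturbation x S with hq
  -- Any `ε` up to this bound keeps both the slope loss `ε * A` and the derivative factor `ε * B` at
  -- most `δ`.
  have hε₀ : 0 < δ / (A + B) := by positivity
  have main : ∀ ε d, 0 ≤ ε → ε ≤ δ / (A + B) → E d (F.eval d + ε * q.eval d) →
      (if b then v = d else F.eval d + ε * q.eval d = v) →
      ∃ (G : ℝ[X]) (T : Finset ℝ), IsStage E x (c - δ) G T ∧ S ⊆ T ∧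
      (∀ s ∈ S, G.eval s = F.eval s) ∧
      (∀ (k : ℕ) (t : ℝ), |t| ≤ R → |(derivative^[k] (G - F)).eval t| ≤ δ * M k) ∧
      (if b then v ∈ T else ∃ s ∈ T, G.eval s = v) := by
    intro ε d hε hε' hEd hdone
    rw [le_div_iff₀ (by positivity)] at hε'
    have hεA : ε * A ≤ δ := by nlinarith
    have hεB : ε * B ≤ δ := by nlinarith
    have hG : ∀ t, (F + C ε * q).eval t = F.eval t + ε * q.eval t := fun t => by simp
    have hGS : ∀ s ∈ S, (F + C ε * q).eval s = F.eval s := fun s hs => by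
      rw [hG, hq, eval_perturbation_of_mem hs, mul_zero, add_zero]
    refine ⟨F + C ε * q, insert d S, ⟨fun s t hst => ?_, Finset.mem_insert_of_mem h.mem, ?_,
      fun s hs hsx => ?_⟩, Finset.subset_insert _ _, hGS, fun k t ht => ?_, ?_⟩
    · rw [hG, hG]
      have h1 := h.slope s t hst
      have h2 := mul_le_mul_of_nonneg_left (hslope s t hst) hε
      have h3 := mul_le_mul_of_nonneg_right hεA (sub_nonneg.2 hst)
      linarith
    · rw [hGS x h.mem, h.root]
    · rcases Finset.mem_insert.1 hs with rfl | hs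
      · rwa [hG]
      · rw [hGS s hs]
        exact h.rel s hs hsx
    · rw [add_sub_cancel_left, iterate_derivative_C_mul, eval_mul, eval_C, abs_mul,
        abs_of_nonneg hε]
      calc ε * |(derivative^[k] q).eval t| ≤ ε * (B * M k) :=
            mul_le_mul_of_nonneg_left (hbound k t ht) hε
        _ = ε * B * M k := by ring
        _ ≤ δ * M k := mul_le_mul_of_nonneg_right hεB (hM k).le
    · cases b with
      | true =>
        simp only [if_true] at hdone ⊢
        exact hdone ▸ Finset.mem_insert_self _ _
      | false =>
        simp only [Bool.false_eq_true, if_false] at hdone ⊢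
        exact ⟨d, Finset.mem_insert_self _ _, by rw [hG, hdone]⟩
  have trivial_case : (if b then v ∈ S else ∃ s ∈ S, F.eval s = v) →
      ∃ (G : ℝ[X]) (T : Finset ℝ), IsStage E x (c - δ) G T ∧ S ⊆ T ∧
      (∀ s ∈ S, G.eval s = F.eval s) ∧
      (∀ (k : ℕ) (t : ℝ), |t| ≤ R → |(derivative^[k] (G - F)).eval t| ≤ δ * M k) ∧
      (if b then v ∈ T else ∃ s ∈ T, G.eval s = v) := by
    refine fun hd => ⟨F, S, ⟨fun s t hst => ?_, h.mem, h.root, h.rel⟩, subset_rfl, fun s _ => rfl,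
      fun k t _ => ?_, hd⟩
    · nlinarith [h.slope s t hst]
    · simpa using mul_nonneg hδ.le (hM k).le
  have hlin : ∀ {w d : ℝ}, q.eval d ≠ 0 → F.eval d + (w - F.eval d) / q.eval d * q.eval d = w :=
    fun h => by rw [div_mul_cancel₀ _ h]; ring
  cases b with
  | true =>
    by_cases hv : v ∈ S
    · exact trivial_case (by simpa using hv)
    have hpos := prod_sub_sq_pos hv
    have hvx : v ≠ x := fun h' => hv (h' ▸ h.mem)
    have hqv : q.eval v ≠ 0 := by
      rw [hq, eval_perturbation]
      exact mul_ne_zero (sub_ne_zero.2 hvx) hpos.ne'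
    have hU : IsOpen {w : ℝ | (w - F.eval v) / q.eval v ∈ Set.Ioo 0 (δ / (A + B))} :=
      isOpen_Ioo.preimage (by fun_prop)
    obtain ⟨w, hw, hwE⟩ := (hE₁ v).exists_mem_open hU
      ⟨F.eval v + δ / (A + B) / 2 * q.eval v, by
        simp only [Set.mem_ofPred_eq, add_sub_cancel_left, mul_div_cancel_right₀ _ hqv]
        constructor <;> linarith⟩
    exact main _ v hwE.1.le hwE.2.le (by rw [hlin hqv]; exact hw) (by simp)
  | false =>
    obtain ⟨d₀, hd₀⟩ := surjective_of_continuous_of_slope F.continuous hc h.slope v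
    replace hd₀ : F.eval d₀ = v := hd₀
    by_cases hdS : d₀ ∈ S
    · exact trivial_case (by simpa using ⟨d₀, hdS, hd₀⟩)
    have hpos := prod_sub_sq_pos hdS
    have hdx : d₀ ≠ x := fun h' => hdS (h' ▸ h.mem)
    have hqd : q.eval d₀ ≠ 0 := by
      rw [hq, eval_perturbation]
      exact mul_ne_zero (sub_ne_zero.2 hdx) hpos.ne'
    have hF : StrictMono fun t => F.eval t := fun s t hst => by
      have := h.slope s t hst.le
      have := mul_pos hc (sub_pos.2 hst)
      dsimp only
      linarith
    -- A new preimage `d` of `v` forces `ε = (v - F d) / q d`. The conditions `0 < ε < δ / (A + B)`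
    -- are multiplied by `q d ^ 2` to remain continuous where `q` vanishes.
    have hU : IsOpen {d : ℝ | 0 < (v - F.eval d) * q.eval d ∧
        (v - F.eval d) * q.eval d < δ / (A + B) * q.eval d ^ 2} :=
      (isOpen_Ioi.preimage (f := fun d => (v - F.eval d) * q.eval d) (by fun_prop)).inter
        (isOpen_lt (f := fun d => (v - F.eval d) * q.eval d)
          (g := fun d => δ / (A + B) * q.eval d ^ 2) (by fun_prop) (by fun_prop))
    have hnear : ∀ᶠ d in nhds d₀, (v - F.eval d) * q.eval d < δ / (A + B) * q.eval d ^ 2 ∧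
        0 < q.eval d * q.eval d₀ := by
      refine (ContinuousAt.eventually_lt (by fun_prop) (by fun_prop) ?_).and
        (ContinuousAt.eventually_lt (by fun_prop) (by fun_prop) ?_)
      · rw [hd₀, sub_self, zero_mul]
        positivity
      · exact mul_self_pos.2 hqd
    have hne : {d : ℝ | 0 < (v - F.eval d) * q.eval d ∧
        (v - F.eval d) * q.eval d < δ / (A + B) * q.eval d ^ 2}.Nonempty := by
      -- The sign of `q` at `d₀` decides on which side of `d₀` the quotient `ε` is positive.
      rcases lt_or_gt_of_ne hqd with hneg | hpos
      · obtain ⟨d, hd, hlt⟩ := ((hnear.filter_mono nhdsWithin_le_nhds).and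
          (self_mem_nhdsWithin (s := Set.Ioi d₀))).exists
        refine ⟨d, mul_pos_of_neg_of_neg ?_ (neg_of_mul_pos_left hd.2 hneg.le), hd.1⟩
        have : F.eval d₀ < F.eval d := hF hlt
        linarith
      · obtain ⟨d, hd, hlt⟩ := ((hnear.filter_mono nhdsWithin_le_nhds).and
          (self_mem_nhdsWithin (s := Set.Iio d₀))).exists
        refine ⟨d, mul_pos ?_ (pos_of_mul_pos_left hd.2 hpos.le), hd.1⟩
        have : F.eval d < F.eval d₀ := hF hlt
        linarith
    obtain ⟨d, hdE, hd1, hd2⟩ := (hE₂ v).exists_mem_open hU hne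
    have hqd' : q.eval d ≠ 0 := right_ne_zero_of_mul hd1.ne'
    have heq : (v - F.eval d) / q.eval d = (v - F.eval d) * q.eval d / q.eval d ^ 2 := by
      field_simp
    refine main ((v - F.eval d) / q.eval d) d ?_ ?_ (by rw [hlin hqd']; exact hdE)
      (by simpa using hlin hqd')
    · rw [heq]; positivity
    · rw [heq, div_le_iff₀ (by positivity)]
      exact hd2.le

/-! ### The limit of the back-and-forth -/

open Polynomial Filter Topology in
/-- For a relation `E` with dense sections there is an increasing bijection `f` in the class with
`f x = 0` which, up to this exception, relates all points of `A` by `E` to their images and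
preimages. -/
theorem exists_mem_denjoyCarlemanLoc_rel {M : ℕ → ℝ} (hM : ∀ k, 0 < M k) {E : ℝ → ℝ → Prop}
    (hE₁ : ∀ u, Dense {v | E u v}) (hE₂ : ∀ v, Dense {u | E u v}) {A : Set ℝ} (hA : A.Countable)
    (x : ℝ) :
    ∃ f ∈ denjoyCarlemanLoc M, StrictMono f ∧ Function.Bijective f ∧ f x = 0 ∧
      ∀ u, u ≠ x → (u ∈ A ∨ f u ∈ A) → E u (f u) := by
  -- `τ` lists the requests: `true` puts a point in the domain, `false` in the range. Inserting `x`
  -- keeps the list nonempty.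
  obtain ⟨τ, hτ⟩ : ∃ τ : ℕ → Bool × ℝ, Set.univ ×ˢ insert x A = Set.range τ :=
    (Set.countable_univ.prod (hA.insert x)).exists_eq_range ⟨(true, x), by simp⟩
  -- The slope bound starts at `1`, the slope of `X - C x`, and loses `δ n` at stage `n`, so it
  -- stays above `1 / 2`.
  let c : ℕ → ℝ := fun n => 1 / 2 + (1 / 2) ^ (n + 1)
  let δ : ℕ → ℝ := fun n => (1 / 2) ^ (n + 2)
  have hc : ∀ n, 0 < c n := fun n => by positivity
  have hδ : ∀ n, 0 < δ n := fun n => by positivity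
  have hcδ : ∀ n, c n - δ n = c (n + 1) := fun n => by simp only [c, δ]; ring
  have hstep : ∀ (n : ℕ) (Z : ℝ[X] × Finset ℝ), ∃ Z' : ℝ[X] × Finset ℝ,
      IsStage E x (c n) Z.1 Z.2 → IsStage E x (c (n + 1)) Z'.1 Z'.2 ∧ Z.2 ⊆ Z'.2 ∧
      (∀ s ∈ Z.2, Z'.1.eval s = Z.1.eval s) ∧
      (∀ (k : ℕ) (t : ℝ), |t| ≤ n → |(derivative^[k] (Z'.1 - Z.1)).eval t| ≤ δ n * M k) ∧
      (if (τ n).1 then (τ n).2 ∈ Z'.2 else ∃ s ∈ Z'.2, Z'.1.eval s = (τ n).2) := by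
    intro n Z
    by_cases hZ : IsStage E x (c n) Z.1 Z.2
    · obtain ⟨G, T, h⟩ := hZ.exists_extension (hc n) hE₁ hE₂ hM (hδ n) n (τ n).1 (τ n).2
      rw [hcδ] at h
      exact ⟨(G, T), fun _ => h⟩
    · exact ⟨Z, fun h => absurd h hZ⟩
  choose next hnext using hstep
  let Z : ℕ → ℝ[X] × Finset ℝ := fun n => Nat.rec (X - C x, {x}) next n
  have hZ : ∀ n, IsStage E x (c n) (Z n).1 (Z n).2 := by
    intro n
    induction n with
    | zero =>
      refine ⟨fun s t _ => le_of_eq ?_, by simp [Z], by simp [Z], by simp [Z]⟩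
      change (1 / 2 + (1 / 2) ^ (0 + 1)) * (t - s) = (X - C x).eval t - (X - C x).eval s
      simp only [eval_sub, eval_X, eval_C]
      ring
    | succ n ih => exact (hnext n (Z n) ih).1
  have hZs : ∀ n, (Z n).2 ⊆ (Z (n + 1)).2 ∧
      (∀ s ∈ (Z n).2, (Z (n + 1)).1.eval s = (Z n).1.eval s) ∧
      (∀ (k : ℕ) (t : ℝ), |t| ≤ n →
        |(derivative^[k] ((Z (n + 1)).1 - (Z n).1)).eval t| ≤ δ n * M k) ∧
      (if (τ n).1 then (τ n).2 ∈ (Z (n + 1)).2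
        else ∃ s ∈ (Z (n + 1)).2, (Z (n + 1)).1.eval s = (τ n).2) :=
    fun n => (hnext n (Z n) (hZ n)).2
  have hmono : Monotone fun n => (Z n).2 := monotone_nat_of_le_succ fun n => (hZs n).1
  have hstable : ∀ n, ∀ s ∈ (Z n).2, ∀ m, n ≤ m → (Z m).1.eval s = (Z n).1.eval s := by
    intro n s hs m hm
    induction m, hm using Nat.le_induction with
    | base => rfl
    | succ m hm ih => rw [← ih]; exact (hZs m).2.1 s (hmono hm hs)
  let p : ℕ → ℝ[X] := fun n => Nat.casesOn n (Z 0).1 fun n => (Z (n + 1)).1 - (Z n).1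
  have hpsum : ∀ n, ∑ i ∈ Finset.range (n + 1), p i = (Z n).1 := by
    intro n
    induction n with
    | zero => simp [p]
    | succ n ih => rw [Finset.sum_range_succ, ih]; simp [p]
  have hδs : Summable δ := (summable_nat_add_iff 2).2
    (summable_geometric_of_lt_one (by norm_num : (0 : ℝ) ≤ 1 / 2) (by norm_num))
  obtain ⟨hsum, hmem⟩ := tsum_eval_mem_denjoyCarlemanLoc hM (p := p) hδs fun n => (hZs n).2.2.1
  set f : ℝ → ℝ := fun t => ∑' n, (p n).eval t with hf
  have hlim : ∀ t, Tendsto (fun n => (Z n).1.eval t) atTop (𝓝 (f t)) := by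
    intro t
    have := ((hsum t).hasSum.tendsto_sum_nat).comp (tendsto_add_atTop_nat 1)
    refine this.congr fun n => ?_
    simp only [Function.comp_apply]
    rw [← hpsum, eval_finsetSum]
  have hfS : ∀ n, ∀ s ∈ (Z n).2, f s = (Z n).1.eval s := fun n s hs =>
    tendsto_nhds_unique (hlim s) (tendsto_const_nhds.congr' (by
      filter_upwards [eventually_ge_atTop n] with m hm
      exact (hstable n s hs m hm).symm))
  have hslope : ∀ s t, s ≤ t → 1 / 2 * (t - s) ≤ f t - f s := fun s t hst =>
    ge_of_tendsto' ((hlim t).sub (hlim s)) fun n => by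
      refine le_trans (mul_le_mul_of_nonneg_right ?_ (sub_nonneg.2 hst)) ((hZ n).slope s t hst)
      simp only [c]
      linarith [pow_pos (one_half_pos (α := ℝ)) (n + 1)]
  have hfmono : StrictMono f := fun s t hst => by
    linarith [hslope s t hst.le]
  refine ⟨f, hmem, hfmono, ⟨hfmono.injective, surjective_of_continuous_of_slope
    hmem.1.continuous one_half_pos hslope⟩, ?_, fun u hux hu => ?_⟩
  · rw [hfS 0 x (hZ 0).mem, (hZ 0).root]
  · obtain ⟨n, hn⟩ : ∃ n, u ∈ (Z n).2 := by
      rcases hu with hu | hu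
      · obtain ⟨n, hn⟩ : (true, u) ∈ Set.range τ := hτ ▸ ⟨trivial, Or.inr hu⟩
        have := (hZs n).2.2.2
        rw [hn] at this
        exact ⟨n + 1, by simpa using this⟩
      · obtain ⟨n, hn⟩ : (false, f u) ∈ Set.range τ := hτ ▸ ⟨trivial, Or.inr hu⟩
        have := (hZs n).2.2.2
        rw [hn] at this
        obtain ⟨s, hs, hsu⟩ : ∃ s ∈ (Z (n + 1)).2, (Z (n + 1)).1.eval s = f u := by
          simpa using this
        rw [← hfS (n + 1) s hs] at hsu
        exact ⟨n + 1, hfmono.injective hsu ▸ hs⟩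
    rw [hfS n u hn]
    exact (hZ n).rel u hn hux

/-! ### The relation from CH and the conclusion -/

/-- Under the continuum hypothesis there is a relation on the reals whose sections, on either side,
are countable and dense, together with countable sets `A x` such that every real belongs to all but
countably many of them. -/
theorem exists_rel_countable_dense (CH : Cardinal.continuum.{0} = Cardinal.aleph 1) :
    ∃ (E : ℝ → ℝ → Prop) (A : ℝ → Set ℝ),
      (∀ u, {v | E u v}.Countable) ∧ (∀ v, {u | E u v}.Countable) ∧
      (∀ u, Dense {v | E u v}) ∧ (∀ v, Dense {u | E u v}) ∧
      (∀ x, (A x).Countable) ∧ ∀ u, {x | u ∉ A x}.Countable := by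
  obtain ⟨r, hr, hcount⟩ := exists_wellOrder_real_countable CH
  have hle : ∀ x, {y | ¬ r x y}.Countable := fun x =>
    ((hcount x).insert x).mono fun y hy =>
      (trichotomous_of r x y).elim (fun h => absurd h hy) fun h => h.elim
        (fun h => Or.inl h.symm) Or.inr
  -- `D u` lies strictly above `u` in the well-order, so `u ∈ D v` only for `v` among the countably
  -- many predecessors of `u`.
  choose D hDc hDd hD using fun u => exists_countable_dense_disjoint (hle u)
  have hDr : ∀ u v, v ∈ D u → r u v := fun u v hv => by
    by_contra h
    exact Set.disjoint_left.1 (hD u) hv h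
  have hc : ∀ u, {v | v ∈ D u ∨ u ∈ D v}.Countable := fun u =>
    ((hDc u).union (hcount u)).mono fun v hv => hv.imp_right (hDr v u)
  have hd : ∀ u, Dense {v | v ∈ D u ∨ u ∈ D v} := fun u => (hDd u).mono fun v hv => Or.inl hv
  refine ⟨fun u v => v ∈ D u ∨ u ∈ D v, fun x => {y | r y x}, hc, fun v => ?_, hd, fun v => ?_,
    hcount, hle⟩
  · simpa only [or_comm] using hc v
  · simpa only [or_comm] using hd v

theorem mainTheorem6 (CH : Cardinal.continuum.{0} = Cardinal.aleph 1)
    (Γ : Set (ℝ → ℝ)) (hΓ : IsLocallyDenjoyCarleman Γ) :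
    ¬ ∃ P : Predictor ℝ, P.IsGood ∧ P.IsAnonymous Γ := by
  rintro ⟨P, hgood, hanon⟩
  obtain ⟨M, hM, rfl⟩ := hΓ
  obtain ⟨E, A, hE₁, hE₂, hd₁, hd₂, hA, hcoA⟩ := exists_rel_countable_dense CH
  choose f hfM hfmono hfbij hf0 hfE using
    fun x => exists_mem_denjoyCarlemanLoc_rel hM hd₁ hd₂ (hA x) x
  -- The point `u = x` is excluded: since `f x x = 0` for every `x`, all reals would otherwise be
  -- related to `0`. Invariance is needed only for `u < x`.
  let R : ℝ → ℝ → Prop := fun u v => ∃ x, u ≠ x ∧ f x u = v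
  have hR₁ : ∀ u, {v | R u v}.Countable := fun u =>
    ((hE₁ u).union ((hcoA u).image fun x => f x u)).mono (by
      rintro v ⟨x, hux, rfl⟩
      by_cases hu : u ∈ A x
      · exact Or.inl (hfE x u hux (Or.inl hu))
      · exact Or.inr ⟨x, hu, rfl⟩)
  have hR₂ : ∀ v, {u | R u v}.Countable := fun v =>
    ((hE₂ v).union ((hcoA v).image fun x => Function.surjInv (hfbij x).2 v)).mono (by
      rintro u ⟨x, hux, rfl⟩
      by_cases hv : f x u ∈ A x
      · exact Or.inl (hfE x u hux (Or.inr hv))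
      · exact Or.inr ⟨x, hv, (hfbij x).1 (Function.surjInv_eq _ _)⟩)
  let F : ℝ → ℝ := fun t => (Quot.mk R t).out
  have hF : ∀ c, {t | F t = c}.Countable := fun c =>
    (countable_setOf_eqvGen hR₁ hR₂ c).mono fun t (ht : F t = c) => by
      refine Quot.eqvGen_exact ?_
      rw [← ht]
      exact Quot.out_eq _
  exact Predictor.not_isGood_of_forall_exists hanon hF (fun x => ⟨f x, hfM x, hfmono x, hfbij x,
    hf0 x, fun u hu => congrArg Quot.out (Quot.sound ⟨x, hu.ne, rfl⟩).symm⟩) hgood
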